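/- Let $R,G,\rho>0$ and $G',L\ge 0$. There are constants $c,K>0$, depending only on $R,G,G',L,\rho$, such that the following holds for all integers $d\ge 0$, $n\ge 2$ and all $\theta\in(0,1]$, $\alpha\in(0,\infty)$, $\delta\in(0,1)$. Let $\mathbb P$ be a probability distribution on a measurable space $\mathcal Z$, let $\mathcal W\subseteq\mathbb R^d$ be closed and convex with $\|\mathbf w\|_2\le R$ for all $\mathbf w\in\mathcal W$, and put $P(\mathbf w)=\mathbb E_{\mathbf z\sim\mathbb P}[f(\mathbf w,\mathbf z)]+r(\mathbf w)$, $P_*=\min_{\mathcal W}P$, $\mathcal W_*=\arg\min_{\mathcal W}P$, where (a) $f(\mathbf w,\cdot)$ is $\mathbb P$-integrable for each $\mathbf w\in\mathcal W$, and for each $\mathbf z\in\mathcal Z$ the loss $f(\cdot,\mathbf z)$ is $G$-Lipschitz on $\mathcal W$ and is non-negative, differentiable, convex and $L$-smooth on the open $\rho$-neighbourhood $\mathcal W^\rho$ of $\mathcal W$, i.e. $0\le f(\mathbf w,\mathbf z)-f(\mathbf u,\mathbf z)-\nabla f(\mathbf u,\mathbf z)^\top(\mathbf w-\mathbf u)\le\frac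 L2\|\mathbf w-\mathbf u\|_2^2$ for all $\mathbf w,\mathbf u\in\mathcal W^\rho$; (b) the regularizer $r$ is non-negative, convex and $G'$-Lipschitz on $\mathcal W$ (it may be nonsmooth, or zero); (c) the error bound condition EBC$(\theta,\alpha)$ holds: for every $\mathbf w\in\mathcal W$ and the point $\mathbf w^*\in\mathcal W_*$ closest to $\mathbf w$, $\|\mathbf w-\mathbf w^*\|_2^2\le\alpha\,(P(\mathbf w)-P(\mathbf w^*))^\theta$. Let $\mathbf z_1,\dots,\mathbf z_n$ be i.i.d. from $\mathbb P$, and let $\widehat{\mathbf w}$ denote any minimizer over $\mathcal W$ of the empirical risk $\frac1n\sum_{i=1}^n f(\mathbf w,\mathbf z_i)+r(\mathbf w)$. Write $C=d\log n+\log(1/\delta)$. Then with probability at least $1-\delta$, every such $\widehat{\mathbf w}$ satisfies $$P(\widehat{\mathbf w})-P_*\le K\left(\frac{C}{n}+\max(1,\alpha^{1/\theta})\left[\frac{C\,P_*}{n}\right]^{\frac1{2-\theta}}\right).$$ If moreover $n\ge c\,(\alpha^{1/\theta}d\log n)^{2-\theta}$, then with probability at least $1-\delta$, every such $\widehat{\mathbf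 w}$ satisfies $$P(\widehat{\mathbf w})-P_*\le K\max(1,\alpha^{1/\theta})\left(\left[\frac{C}{n}\right]^{\frac2{2-\theta}}+\left[\frac{C\,P_*}{n}\right]^{\frac1{2-\theta}}\right).$$ -/

import Mathlib

open MeasureTheory

noncomputable section

/-- `ℝ^d` with the Euclidean norm. -/
abbrev Vec (d : ℕ) : Type := EuclideanSpace ℝ (Fin d)

/-- The set of minimizers of `φ` over `W`. -/
def argminOn {d : ℕ} (W : Set (Vec d)) (φ : Vec d → ℝ) : Set (Vec d) :=
  {w | w ∈ W ∧ ∀ u ∈ W, φ w ≤ φ u}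

/-- The optimal value of `φ` over `W`. -/
def optValue {d : ℕ} (W : Set (Vec d)) (φ : Vec d → ℝ) : ℝ :=
  sInf (φ '' W)

/-- The risk `P(w) = 𝔼_{z ∼ μ}[f(w, z)] + r(w)`. -/
def risk {d : ℕ} {Z : Type*} [MeasurableSpace Z] (μ : Measure Z)
    (f : Vec d → Z → ℝ) (r : Vec d → ℝ) (w : Vec d) : ℝ :=
  (∫ z, f w z ∂μ) + r w

/-- The empirical risk `P_n(w) = (1/n) ∑ i, f(w, z_i) + r(w)` of the sample `z`. -/
def empRisk {d n : ℕ} {Z : Type*} (f : Vec d → Z → ℝ) (r : Vec d → ℝ)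
    (z : Fin n → Z) (w : Vec d) : ℝ :=
  (1 / (n : ℝ)) * (∑ i, f w (z i)) + r w

/-- The error bound condition `EBC(θ, α)` for minimizing `P` over `W`: every `w ∈ W` and every
minimizer `w'` of `P` over `W` that is closest to `w` satisfy
`‖w - w'‖² ≤ α (P(w) - P(w'))^θ`. -/
def ErrorBoundCondition {d : ℕ} (W : Set (Vec d)) (P : Vec d → ℝ) (θ α : ℝ) : Prop :=
  ∀ w ∈ W, ∀ w' ∈ argminOn W P, (∀ u ∈ argminOn W P, ‖w' - w‖ ≤ ‖u - w‖) →
    ‖w - w'‖ ^ 2 ≤ α * (P w - P w') ^ θ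

/-- `g` is non-negative, differentiable, convex and `L`-smooth on the open set `U`. -/
def NonnegSmoothConvexOn {d : ℕ} (U : Set (Vec d)) (L : ℝ) (g : Vec d → ℝ) : Prop :=
  (∀ w ∈ U, 0 ≤ g w) ∧ (∀ w ∈ U, DifferentiableAt ℝ g w) ∧
    ∀ w ∈ U, ∀ u ∈ U,
      0 ≤ g w - g u - inner ℝ (gradient g u) (w - u) ∧
        g w - g u - inner ℝ (gradient g u) (w - u) ≤ L / 2 * ‖w - u‖ ^ 2

/-- `g` is Lipschitz continuous with constant `G` on `W`. -/
def LipschitzBoundOn {d : ℕ} (W : Set (Vec d)) (G : ℝ) (g : Vec d → ℝ) : Prop :=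
  ∀ w ∈ W, ∀ u ∈ W, |g w - g u| ≤ G * ‖w - u‖

/-- The data `(W, μ, f, r)` of the risk minimization problem satisfy all the assumptions:
`W` is closed, convex and contained in the ball of radius `R`; the loss `f(·, z)` is integrable
in `z`, `G`-Lipschitz on `W`, and non-negative, convex and `L`-smooth on the open
`ρ`-neighbourhood of `W`; the regularizer `r` is non-negative, convex and `G'`-Lipschitz on `W`;
and the problem satisfies `EBC(θ, α)`. -/
structure RiskAssumptions {d : ℕ} {Z : Type*} [MeasurableSpace Z] (R G G' L ρ θ α : ℝ)
    (W : Set (Vec d)) (μ : Measure Z) (f : Vec d → Z → ℝ) (r : Vec d → ℝ) : Prop where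
  isClosed : IsClosed W
  convex : Convex ℝ W
  norm_le : ∀ w ∈ W, ‖w‖ ≤ R
  integrable : ∀ w ∈ W, Integrable (f w) μ
  lipschitz_loss : ∀ z, LipschitzBoundOn W G (fun w => f w z)
  smooth_loss : ∀ z, NonnegSmoothConvexOn (Metric.thickening ρ W) L (fun w => f w z)
  nonneg_reg : ∀ w ∈ W, 0 ≤ r w
  convex_reg : ConvexOn ℝ W r
  lipschitz_reg : LipschitzBoundOn W G' r
  error_bound : ErrorBoundCondition W (risk μ f r) θ α

/-- With probability at least `1 - δ` over `n` i.i.d. samples from `μ`, every empirical risk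
minimizer `w` satisfies `P(w) - P_* ≤ B`. -/
def ERMBound {d : ℕ} {Z : Type*} [MeasurableSpace Z] (n : ℕ) (δ : ℝ)
    (W : Set (Vec d)) (μ : Measure Z) (f : Vec d → Z → ℝ) (r : Vec d → ℝ) (B : ℝ) : Prop :=
  ∃ A : Set (Fin n → Z), MeasurableSet A ∧
    ENNReal.ofReal (1 - δ) ≤ Measure.pi (fun _ : Fin n => μ) A ∧
    ∀ z ∈ A, ∀ w ∈ argminOn W (empRisk f r z),
      risk μ f r w - optValue W (risk μ f r) ≤ B

/-- The complexity term `d log n + log(1/δ)`. -/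
def complexity (d n : ℕ) (δ : ℝ) : ℝ :=
  (d : ℝ) * Real.log n + Real.log (1 / δ)

end

/-! Write F for the mean loss, u for the minimizer of P closest to an empirical minimizer w, D = ‖w
- u‖, Δ = P(w) - P_* and x = C/n. A non-negative smooth function is self-bounding
(`sq_sub_le_of_smooth`), so the increment f(w,z) - f(u,z) has range of order D and second moment of
order D² (F(w) + F(u)) ≤ D² (2 P_* + Δ).

Bernstein's inequality over all pairs of a net of mesh n⁻² costs a factor of order C and compares
the increments of F with the empirical ones uniformly (`exists_uniform_deviation`). Both Bernstein
terms keep the factor D up to O(n⁻²), so no localization is needed. The regularizer cancels in this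
comparison, and optimality of w gives Δ ≲ n⁻² + D √(x (P_* + Δ)) + D x. AM-GM absorbs the Δ under
the root, leaving Δ ≲ n⁻² + D x + D √(x P_*) (`exists_excess_risk_bound`).

One of the three terms dominates. The first is O(x²) when d ≥ 1. A bound Δ ≲ D √s together with D² ≤
α Δ^θ solves to Δ ≲ max(1, α^(1/θ)) s^(1/(2-θ)) (`le_of_error_bound`); this is applied with s = x
P_* and with s = x². Using D ≤ 2R in D x instead produces the linear term of the first bound. -/

/-! ### Self-bounding property of smooth losses. -/

/-- A non-negative function that is smooth near `W` and Lipschitz on `W` is self-bounding: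
its squared increments are controlled by its values. -/
theorem sq_sub_le_of_smooth {d : ℕ} {W : Set (Vec d)} {G L ρ : ℝ} (hG : 0 < G) (hL : 0 ≤ L)
    (hρ : 0 < ρ) {g : Vec d → ℝ} (hg : NonnegSmoothConvexOn (Metric.thickening ρ W) L g)
    (hlip : LipschitzBoundOn W G g) {w u : Vec d} (hw : w ∈ W) (hu : u ∈ W) :
    (g w - g u) ^ 2 ≤ 2 * (L + 2 * G / ρ) * ‖w - u‖ ^ 2 * (g w + g u) := by
  have hsub : W ⊆ Metric.thickening ρ W := Metric.self_subset_thickening hρ W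
  have key : ∀ w ∈ W, ∀ u ∈ W, g u ≤ g w →
      (g w - g u) ^ 2 ≤ 2 * (L + 2 * G / ρ) * ‖w - u‖ ^ 2 * g w := by
    intro w hw u hu hle
    obtain ⟨h0, -, h1⟩ := hg
    -- The summand `2 * G / ρ` keeps the trial point `w + τ • (u - w)` within ρ of `w`, however
    -- small `L` is.
    set M := L + 2 * G / ρ with hM
    have hMG : 2 * G ≤ M * ρ := by
      rw [hM, add_mul, div_mul_cancel₀ _ hρ.ne']
      nlinarith
    have hM0 : 0 < M := by positivity
    rcases eq_or_ne w u with rfl | hne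
    · simp
    set D := ‖w - u‖ with hD
    have hD0 : 0 < D := norm_pos_iff.2 (sub_ne_zero.2 hne)
    set q := g w - g u with hq
    have hq0 : 0 ≤ q := sub_nonneg.2 hle
    have hqG : q ≤ G * D := (le_abs_self _).trans (hlip w hw u hu)
    -- Minimizer of -τq + Mτ²D²/2, which bounds the change of `g` from `w` to the trial point:
    -- convexity bounds the slope by -q, smoothness the curvature. Since `g` stays non-negative
    -- there, τq/2 ≤ g w.
    set τ := q / (M * D ^ 2) with hτ
    have hτ0 : 0 ≤ τ := by positivity
    have hτM : τ * (M * D ^ 2) = q := div_mul_cancel₀ _ (by positivity)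
    have hv : w + τ • (u - w) ∈ Metric.thickening ρ W := by
      refine Metric.mem_thickening_iff.2 ⟨w, hw, ?_⟩
      rw [dist_eq_norm, add_sub_cancel_left, norm_smul, Real.norm_of_nonneg hτ0, norm_sub_rev,
        ← hD, hτ, div_mul_eq_mul_div, div_lt_iff₀ (by positivity)]
      have : q * D ≤ G * D ^ 2 := by nlinarith
      have h2 : 2 * G * D ^ 2 ≤ M * ρ * D ^ 2 := by gcongr
      have h3 : 0 < G * D ^ 2 := by positivity
      nlinarith
    have h2 := (h1 u (hsub hu) w (hsub hw)).1
    have h3 := (h1 _ hv w (hsub hw)).2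
    have h4 := h0 _ hv
    rw [add_sub_cancel_left, inner_smul_right, norm_smul, Real.norm_of_nonneg hτ0,
      norm_sub_rev, ← hD] at h3
    have h5 : τ * inner ℝ (gradient g w) (u - w) ≤ τ * (-q) :=
      mul_le_mul_of_nonneg_left (by rw [hq]; linarith) hτ0
    have h6 : L / 2 * (τ * D) ^ 2 ≤ M / 2 * (τ * D) ^ 2 := by
      gcongr
      rw [hM]
      linarith [show 0 ≤ 2 * G / ρ by positivity]
    have h7 : M / 2 * (τ * D) ^ 2 = τ * q / 2 := by rw [← hτM]; ring
    have h8 : τ * q ≤ 2 * g w := by linarith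
    calc q ^ 2 = (M * D ^ 2) * (τ * q) := by rw [← hτM]; ring
      _ ≤ (M * D ^ 2) * (2 * g w) := by gcongr
      _ = _ := by ring
  have hM0 : 0 ≤ 2 * (L + 2 * G / ρ) * ‖w - u‖ ^ 2 := by positivity
  rcases le_total (g u) (g w) with h | h
  · exact (key w hw u hu h).trans
      (mul_le_mul_of_nonneg_left (by linarith [hg.1 u (hsub hu)]) hM0)
  · have := key u hu w hw h
    rw [norm_sub_rev] at this
    nlinarith [mul_nonneg hM0 (hg.1 w (hsub hw))]

/-! ### Bernstein's inequality for i.i.d. samples. -/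

/-- Exponential moment bound for a function bounded by `b` with second moment at most `V`. -/
theorem integral_exp_centered_le {Z : Type*} [MeasurableSpace Z] {μ : Measure Z}
    [IsProbabilityMeasure μ] {g : Z → ℝ} (hg : Integrable g μ) {b V l : ℝ}
    (hb : ∀ z, |g z| ≤ b) (hV : ∫ z, g z ^ 2 ∂μ ≤ V) (hl : 0 ≤ l) (hlb : l * b ≤ 1) :
    ∫ z, Real.exp (l * ((∫ y, g y ∂μ) - g z)) ∂μ ≤ Real.exp (l ^ 2 * V) := by
  set m := ∫ y, g y ∂μ with hm
  have hsq : Integrable (fun z => g z ^ 2) μ := by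
    refine Integrable.of_bound (hg.aestronglyMeasurable.pow 2) (b ^ 2)
      (Filter.Eventually.of_forall fun z => ?_)
    rw [norm_pow, Real.norm_eq_abs]
    exact pow_le_pow_left₀ (abs_nonneg _) (hb z) 2
  have hpt : ∀ z, Real.exp (l * (m - g z)) ≤
      Real.exp (l * m) * (1 - l * g z + l ^ 2 * g z ^ 2) := by
    intro z
    rw [mul_sub, sub_eq_add_neg, Real.exp_add]
    refine mul_le_mul_of_nonneg_left ?_ (Real.exp_nonneg _)
    -- `l * b ≤ 1` enters here: |eʸ - 1 - y| ≤ y² for |y| ≤ 1.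
    have h := Real.abs_exp_sub_one_sub_id_le (x := -(l * g z)) (by
      rw [abs_neg, abs_mul, abs_of_nonneg hl]
      exact (mul_le_mul_of_nonneg_left (hb z) hl).trans hlb)
    nlinarith [le_abs_self (Real.exp (-(l * g z)) - 1 - -(l * g z))]
  have hint : Integrable (fun z => Real.exp (l * m) * (1 - l * g z + l ^ 2 * g z ^ 2)) μ :=
    (((integrable_const _).sub (hg.const_mul l)).add (hsq.const_mul _)).const_mul _
  have hval : ∫ z, (1 - l * g z + l ^ 2 * g z ^ 2) ∂μ = 1 - l * m + l ^ 2 * ∫ z, g z ^ 2 ∂μ := by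
    have h1 : Integrable (fun z => 1 - l * g z) μ := (integrable_const _).sub (hg.const_mul l)
    rw [integral_add h1 (hsq.const_mul _), integral_sub (integrable_const _) (hg.const_mul l),
      integral_const_mul, integral_const_mul]
    simp [hm]
  calc _ ≤ ∫ z, Real.exp (l * m) * (1 - l * g z + l ^ 2 * g z ^ 2) ∂μ :=
        integral_mono_of_nonneg (Filter.Eventually.of_forall fun z => Real.exp_nonneg _) hint
          (Filter.Eventually.of_forall hpt)
    _ = Real.exp (l * m) * (1 - l * m + l ^ 2 * ∫ z, g z ^ 2 ∂μ) := by
        rw [integral_const_mul, hval]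
    _ ≤ Real.exp (l * m) * Real.exp (-(l * m) + l ^ 2 * V) := by
        gcongr
        have := Real.add_one_le_exp (-(l * m) + l ^ 2 * V)
        nlinarith [mul_le_mul_of_nonneg_left hV (sq_nonneg l)]
    _ = _ := by rw [← Real.exp_add]; congr 1; ring

/-- Chernoff's bound for the lower deviations of an empirical sum. -/
theorem pi_chernoff {Z : Type*} [MeasurableSpace Z] {μ : Measure Z}
    [IsProbabilityMeasure μ] {g : Z → ℝ} (hg : Integrable g μ) {b V l : ℝ} (n : ℕ) (t : ℝ)
    (hb : ∀ z, |g z| ≤ b) (hV : ∫ z, g z ^ 2 ∂μ ≤ V) (hl : 0 ≤ l) (hlb : l * b ≤ 1) :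
    Measure.pi (fun _ : Fin n => μ)
      {z | n * (l ^ 2 * V) + t ≤ l * ∑ i, ((∫ y, g y ∂μ) - g (z i))} ≤
      ENNReal.ofReal (Real.exp (-t)) := by
  set φ : Z → ℝ := fun z => Real.exp (l * ((∫ y, g y ∂μ) - g z)) with hφ
  set ν := Measure.pi (fun _ : Fin n => μ)
  have hφi : Integrable φ μ := by
    refine Integrable.of_bound (C := Real.exp (l * ((∫ y, g y ∂μ) + b))) ?_
      (Filter.Eventually.of_forall fun z => ?_)
    · exact Real.continuous_exp.comp_aestronglyMeasurable
        ((aestronglyMeasurable_const.sub hg.aestronglyMeasurable).const_mul l)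
    · rw [Real.norm_of_nonneg (Real.exp_nonneg _)]
      refine Real.exp_le_exp.2 (mul_le_mul_of_nonneg_left ?_ hl)
      linarith [neg_abs_le (g z), hb z]
  have hint : Integrable (fun z : Fin n → Z => ∏ i, φ (z i)) ν :=
    Integrable.fintype_prod (fun _ => hφi)
  have hval : ∫ z : Fin n → Z, ∏ i, φ (z i) ∂ν ≤ Real.exp (n * (l ^ 2 * V)) := by
    rw [integral_fintype_prod_eq_pow, Fintype.card_fin, Real.exp_nat_mul]
    exact pow_le_pow_left₀ (integral_nonneg fun z => Real.exp_nonneg _)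
      (integral_exp_centered_le hg hb hV hl hlb) n
  have hmk := mul_meas_ge_le_integral_of_nonneg (μ := ν)
    (Filter.Eventually.of_forall fun z => Finset.prod_nonneg fun i _ => Real.exp_nonneg _)
    hint (Real.exp (n * (l ^ 2 * V) + t))
  have hset : {z : Fin n → Z | Real.exp (n * (l ^ 2 * V) + t) ≤ ∏ i, φ (z i)} =
      {z | n * (l ^ 2 * V) + t ≤ l * ∑ i, ((∫ y, g y ∂μ) - g (z i))} := by
    ext z
    simp only [hφ, Set.mem_ofPred_eq, ← Real.exp_sum, Real.exp_le_exp, Finset.mul_sum]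
  rw [hset, Real.exp_add, mul_assoc] at hmk
  have h2 := le_of_mul_le_mul_left (hmk.trans (hval.trans_eq (mul_one _).symm)) (Real.exp_pos _)
  rw [← ENNReal.ofReal_toReal (measure_ne_top ν _)]
  refine ENNReal.ofReal_le_ofReal ?_
  rw [Real.exp_neg, ← one_div, le_div_iff₀ (Real.exp_pos _), mul_comm]
  exact h2

/-- Bernstein's inequality for the lower deviations of an empirical mean. -/
theorem pi_bernstein {Z : Type*} [MeasurableSpace Z] {μ : Measure Z}
    [IsProbabilityMeasure μ] {g : Z → ℝ} (hg : Integrable g μ) {b V s : ℝ} {n : ℕ}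
    (hn : 0 < n) (hs : 0 < s) (hb0 : 0 < b) (hb : ∀ z, |g z| ≤ b)
    (hV : ∫ z, g z ^ 2 ∂μ ≤ V) :
    Measure.pi (fun _ : Fin n => μ)
      {z | 2 * √(V * s) + b * s < (∫ y, g y ∂μ) - 1 / (n : ℝ) * ∑ i, g (z i)} ≤
      ENNReal.ofReal (Real.exp (-(n * s))) := by
  have hn' : (0 : ℝ) < n := Nat.cast_pos.2 hn
  have hV0 : 0 ≤ V := (integral_nonneg fun z => sq_nonneg _).trans hV
  -- The unconstrained optimum is l = √s/√V; when it is not below the cap 1/b, the cap itself is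
  -- used and the linear term `b * s` takes over.
  obtain ⟨l, hl, hlb, hle⟩ : ∃ l : ℝ, 0 < l ∧ l * b ≤ 1 ∧
      l ^ 2 * V + s ≤ l * (2 * √(V * s) + b * s) := by
    rw [Real.sqrt_mul hV0]
    have h1 := Real.sq_sqrt hV0
    have h2 := Real.sq_sqrt hs.le
    have h3 := Real.sqrt_nonneg V
    have h4 := Real.sqrt_pos.2 hs
    set a := √V
    set e := √s
    rw [← h1, ← h2]
    rcases le_or_gt a (b * e) with h | h
    · refine ⟨1 / b, by positivity, by rw [one_div_mul_cancel hb0.ne'], ?_⟩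
      have : (1 / b) * a ≤ e := by rw [one_div_mul_eq_div, div_le_iff₀ hb0]; linarith
      have h5 : (1 / b) * (b * e ^ 2) = e ^ 2 := by field_simp
      have h6 : 0 ≤ 1 / b * a := by positivity
      nlinarith
    · have ha : 0 < a := lt_of_le_of_lt (by positivity) h
      refine ⟨e / a, by positivity, ?_, ?_⟩
      · rw [div_mul_eq_mul_div, div_le_one ha]; linarith
      · have h5 : (e / a) ^ 2 * a ^ 2 = e ^ 2 := by field_simp
        have h6 : e / a * (2 * (a * e)) = 2 * e ^ 2 := by field_simp
        have h7 : 0 ≤ e / a * (b * e ^ 2) := by positivity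
        nlinarith
  refine (measure_mono ?_).trans (pi_chernoff hg n (n * s) hb hV hl.le hlb)
  intro z hz
  simp only [Set.mem_ofPred_eq] at hz ⊢
  have h1 : ∑ i, ((∫ y, g y ∂μ) - g (z i)) =
      n * ((∫ y, g y ∂μ) - 1 / (n : ℝ) * ∑ i, g (z i)) := by
    rw [Finset.sum_sub_distrib, mul_sub, ← mul_assoc, mul_one_div_cancel hn'.ne']
    simp
  rw [h1]
  calc (n : ℝ) * (l ^ 2 * V) + n * s = n * (l ^ 2 * V + s) := by ring
    _ ≤ n * (l * (2 * √(V * s) + b * s)) := by gcongr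
    _ ≤ n * (l * ((∫ y, g y ∂μ) - 1 / (n : ℝ) * ∑ i, g (z i))) := by gcongr
    _ = _ := by ring

/-! ### Nets and union bounds. -/

/-- A subset of the ball of radius `R` contains a finite net of mesh `√d h`, with one point for
each cell of a grid. -/
theorem exists_finset_net {d : ℕ} {W : Set (Vec d)} {R h : ℝ} (hR : 0 ≤ R) (hh : 0 < h)
    (hW : ∀ w ∈ W, ‖w‖ ≤ R) :
    ∃ T : Finset (Vec d), (∀ u ∈ T, u ∈ W) ∧ ((T.card : ℝ) ≤ (2 * R / h + 1) ^ d) ∧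
      ∀ w ∈ W, ∃ u ∈ T, ‖w - u‖ ≤ √d * h := by
  classical
  set m := ⌊2 * R / h⌋₊ with hm
  let c : Vec d → Fin d → ℕ := fun w i => ⌊(w i + R) / h⌋₊
  have hcoord : ∀ w ∈ W, ∀ i, |w i| ≤ R := fun w hw i =>
    (by simpa using PiLp.norm_apply_le w i : |w i| ≤ ‖w‖).trans (hW w hw)
  let S : Finset (Fin d → ℕ) := Fintype.piFinset fun _ => Finset.range (m + 1)
  have hcS : ∀ w ∈ W, c w ∈ S := by
    intro w hw
    simp only [S, Fintype.mem_piFinset, Finset.mem_range, c]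
    intro i
    refine Nat.lt_succ_of_le (Nat.floor_mono ?_)
    gcongr
    linarith [(abs_le.1 (hcoord w hw i)).2]
  -- Each occupied cell is represented by a point of `W`, since the loss is controlled only near
  -- `W`. The default 0 of empty cells is discarded by the filter unless it lies in `W`.
  let rep : (Fin d → ℕ) → Vec d := fun k => if hk : ∃ w ∈ W, c w = k then hk.choose else 0
  have hrep : ∀ w ∈ W, rep (c w) ∈ W ∧ c (rep (c w)) = c w := by
    intro w hw
    have hk : ∃ w' ∈ W, c w' = c w := ⟨w, hw, rfl⟩
    simp only [rep, dif_pos hk]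
    exact hk.choose_spec
  refine ⟨(S.image rep).filter (· ∈ W), fun u hu => (Finset.mem_filter.1 hu).2, ?_, ?_⟩
  · have h1 : ((S.image rep).filter (· ∈ W)).card ≤ (m + 1) ^ d := by
      refine (Finset.card_filter_le _ _).trans (Finset.card_image_le.trans ?_)
      simp [S]
    have h2 : (m : ℝ) ≤ 2 * R / h := Nat.floor_le (by positivity)
    calc _ ≤ (((m + 1) ^ d : ℕ) : ℝ) := by exact_mod_cast h1
      _ = ((m : ℝ) + 1) ^ d := by push_cast; rfl
      _ ≤ _ := by gcongr
  · intro w hw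
    obtain ⟨h1, h2⟩ := hrep w hw
    refine ⟨rep (c w), Finset.mem_filter.2 ⟨Finset.mem_image_of_mem _ (hcS w hw), h1⟩, ?_⟩
    have h3 : ∀ i, ((w - rep (c w)) i) ^ 2 ≤ h ^ 2 := by
      intro i
      have hi : c (rep (c w)) i = c w i := congrFun h2 i
      simp only [c] at hi
      set u := rep (c w)
      have hu0 : 0 ≤ (u i + R) / h := by
        have := (abs_le.1 (hcoord u h1 i)).1
        exact div_nonneg (by linarith) hh.le
      have hw0 : 0 ≤ (w i + R) / h := by
        have := (abs_le.1 (hcoord w hw i)).1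
        exact div_nonneg (by linarith) hh.le
      have a1 := Nat.floor_le hu0
      have a2 := Nat.lt_floor_add_one ((u i + R) / h)
      have b1 := Nat.floor_le hw0
      have b2 := Nat.lt_floor_add_one ((w i + R) / h)
      have e : (w i + R) / h - (u i + R) / h = (w i - u i) / h := by ring
      have hi' : (⌊(u i + R) / h⌋₊ : ℝ) = ⌊(w i + R) / h⌋₊ := by exact_mod_cast hi
      have k1 : (w i - u i) / h ≤ 1 := by linarith
      have k2 : -1 ≤ (w i - u i) / h := by linarith
      rw [div_le_one hh] at k1
      rw [le_div_iff₀ hh] at k2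
      rw [PiLp.sub_apply]
      exact sq_le_sq' (by linarith) (by linarith)
    rw [EuclideanSpace.norm_eq, ← Real.sqrt_sq hh.le, ← Real.sqrt_mul (Nat.cast_nonneg d)]
    refine Real.sqrt_le_sqrt ?_
    calc ∑ i, ‖(w - rep (c w)) i‖ ^ 2 ≤ ∑ _i : Fin d, h ^ 2 :=
          Finset.sum_le_sum fun i _ => by rw [Real.norm_eq_abs, sq_abs]; exact h3 i
      _ = _ := by simp

/-- The half is a lower bound for the logarithm from `2` on. -/
theorem half_le_log_natCast {n : ℕ} (hn : 2 ≤ n) : 1 / 2 ≤ Real.log n := by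
  have h1 : (2 : ℝ) ≤ n := by exact_mod_cast hn
  have := Real.log_le_log two_pos h1
  linarith [Real.log_two_gt_d9]

theorem complexity_pos {d n : ℕ} {δ : ℝ} (hn : 2 ≤ n) (hδ : 0 < δ) (hδ1 : δ < 1) :
    0 < complexity d n δ := by
  have h1 := half_le_log_natCast hn
  have h2 : 0 < Real.log (1 / δ) := Real.log_pos (by rw [lt_div_iff₀ hδ]; linarith)
  have h3 : (0 : ℝ) ≤ d := Nat.cast_nonneg d
  unfold complexity
  nlinarith

/-- A set of outer measure at most `δ` has a measurable subset of its complement of measure at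
least `1 - δ`. -/
theorem exists_measurableSet_disjoint {Ω : Type*} [MeasurableSpace Ω] {ν : Measure Ω}
    [IsProbabilityMeasure ν] {S : Set Ω} {δ : ℝ} (hδ : 0 ≤ δ) (hS : ν S ≤ ENNReal.ofReal δ) :
    ∃ A : Set Ω, MeasurableSet A ∧ ENNReal.ofReal (1 - δ) ≤ ν A ∧ ∀ z ∈ A, z ∉ S := by
  -- Deviation events need not be measurable, the loss being only a.e. measurable in z, so a
  -- measurable hull is removed.
  refine ⟨(toMeasurable ν S)ᶜ, (measurableSet_toMeasurable ν S).compl, ?_,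
    fun z hz hzS => hz (subset_toMeasurable ν S hzS)⟩
  rw [prob_compl_eq_one_sub (measurableSet_toMeasurable ν S), measure_toMeasurable,
    ENNReal.ofReal_sub _ hδ, ENNReal.ofReal_one]
  exact tsub_le_tsub_left hS 1

/-- Union bound over the pairs of points of a finite set. -/
theorem exists_measurableSet_forall_pairs {d n : ℕ} {Z : Type*} [MeasurableSpace Z]
    (ν : Measure (Fin n → Z)) [IsProbabilityMeasure ν] (T : Finset (Vec d))
    (bad : Vec d → Vec d → Set (Fin n → Z)) {t δ : ℝ} (hδ : 0 ≤ δ)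
    (hbad : ∀ w ∈ T, ∀ u ∈ T, ν (bad w u) ≤ ENNReal.ofReal (Real.exp (-t)))
    (hT : (T.card : ℝ) ^ 2 * Real.exp (-t) ≤ δ) :
    ∃ A : Set (Fin n → Z), MeasurableSet A ∧ ENNReal.ofReal (1 - δ) ≤ ν A ∧
      ∀ z ∈ A, ∀ w ∈ T, ∀ u ∈ T, z ∉ bad w u := by
  have hS : ν (⋃ p ∈ T ×ˢ T, bad p.1 p.2) ≤ ENNReal.ofReal δ := by
    calc _ ≤ ∑ p ∈ T ×ˢ T, ν (bad p.1 p.2) := measure_biUnion_finset_le _ _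
      _ ≤ ∑ _p ∈ T ×ˢ T, ENNReal.ofReal (Real.exp (-t)) := Finset.sum_le_sum fun p hp =>
          hbad _ (Finset.mem_product.1 hp).1 _ (Finset.mem_product.1 hp).2
      _ = ENNReal.ofReal ((T.card : ℝ) ^ 2 * Real.exp (-t)) := by
          rw [Finset.sum_const, Finset.card_product, nsmul_eq_mul,
            ENNReal.ofReal_mul (by positivity), ← Nat.cast_pow, ENNReal.ofReal_natCast, sq]
      _ ≤ _ := ENNReal.ofReal_le_ofReal hT
  obtain ⟨A, hA, hA1, hA2⟩ := exists_measurableSet_disjoint hδ hS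
  refine ⟨A, hA, hA1, fun z hz w hw u hu hb => hA2 z hz ?_⟩
  exact Set.mem_biUnion (x := (w, u)) (by simpa using ⟨hw, hu⟩) hb

/-- Union bound for a net of mesh polynomial in `n`. -/
theorem card_sq_mul_exp_le {d n N : ℕ} {R δ : ℝ} (hR : 0 ≤ R) (hn : 2 ≤ n) (hδ : 0 < δ)
    (hδ1 : δ < 1) (hN : (N : ℝ) ≤ (2 * R / (1 / (n : ℝ) ^ 3) + 1) ^ d) :
    (N : ℝ) ^ 2 * Real.exp (-((6 + 8 * R) * complexity d n δ)) ≤ δ := by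
  have hn0 : (0 : ℝ) < n := by exact_mod_cast (by omega : 0 < n)
  have hn1 : (1 : ℝ) ≤ n := by exact_mod_cast (by omega : 1 ≤ n)
  have hlog := half_le_log_natCast hn
  have h1 : 2 * R / (1 / (n : ℝ) ^ 3) + 1 ≤ Real.exp ((3 + 4 * R) * Real.log n) := by
    have e1 : Real.exp (3 * Real.log n) = (n : ℝ) ^ 3 := by
      rw [mul_comm, Real.exp_mul, Real.exp_log hn0]; norm_cast
    -- Since log n ≥ 1/2, the factor 2R + 1 is absorbed into a power of n. The net then has at most
    -- n^((3 + 4R)d) points, and counting pairs doubles the exponent to 6 + 8R.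
    have e2 : 2 * R + 1 ≤ Real.exp (4 * R * Real.log n) := by
      refine (Real.add_one_le_exp _).trans (Real.exp_le_exp.2 ?_)
      nlinarith
    rw [add_mul, Real.exp_add, e1, div_div_eq_mul_div, div_one]
    have e3 : (1 : ℝ) ≤ (n : ℝ) ^ 3 := one_le_pow₀ hn1
    nlinarith
  have h2 : (N : ℝ) ≤ Real.exp (d * ((3 + 4 * R) * Real.log n)) := by
    rw [Real.exp_nat_mul]
    exact hN.trans (pow_le_pow_left₀ (by positivity) h1 d)
  have h3 : (N : ℝ) ^ 2 ≤ Real.exp (2 * (d * ((3 + 4 * R) * Real.log n))) := by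
    have := pow_le_pow_left₀ (Nat.cast_nonneg N) h2 2
    rwa [← Real.exp_nat_mul, Nat.cast_ofNat] at this
  have h4 : 0 ≤ Real.log (1 / δ) := Real.log_nonneg (by rw [le_div_iff₀ hδ]; linarith)
  calc _ ≤ Real.exp (2 * (d * ((3 + 4 * R) * Real.log n))) *
        Real.exp (-((6 + 8 * R) * complexity d n δ)) := by gcongr
    _ = Real.exp (-((6 + 8 * R) * Real.log (1 / δ))) := by
        rw [← Real.exp_add]; congr 1; unfold complexity; ring
    _ ≤ Real.exp (-Real.log (1 / δ)) := Real.exp_le_exp.2 (by nlinarith)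
    _ = δ := by rw [Real.exp_neg, Real.exp_log (by positivity)]; simp

/-! ### Uniform deviation of loss increments. -/

/-- The second moment of an increment of a loss that is smooth near `W`. -/
theorem integral_sq_sub_le {d : ℕ} {Z : Type*} [MeasurableSpace Z] {μ : Measure Z}
    {R G G' L ρ θ α : ℝ} {W : Set (Vec d)} {f : Vec d → Z → ℝ} {r : Vec d → ℝ} (hG : 0 < G)
    (hL : 0 ≤ L) (hρ : 0 < ρ) (hA : RiskAssumptions R G G' L ρ θ α W μ f r) {w u : Vec d}
    (hw : w ∈ W) (hu : u ∈ W) :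
    ∫ z, (f w z - f u z) ^ 2 ∂μ ≤
      2 * (L + 2 * G / ρ) * ‖w - u‖ ^ 2 * (∫ z, f w z ∂μ + ∫ z, f u z ∂μ) := by
  rw [← integral_add (hA.integrable w hw) (hA.integrable u hu), ← integral_const_mul]
  exact integral_mono_of_nonneg (Filter.Eventually.of_forall fun z => sq_nonneg _)
    (((hA.integrable w hw).add (hA.integrable u hu)).const_mul _)
    (Filter.Eventually.of_forall fun z =>
      sq_sub_le_of_smooth hG hL hρ (hA.smooth_loss z) (hA.lipschitz_loss z) hw hu)

theorem abs_integral_sub_le {d : ℕ} {Z : Type*} [MeasurableSpace Z] {μ : Measure Z}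
    [IsProbabilityMeasure μ] {G : ℝ} {W : Set (Vec d)} {f : Vec d → Z → ℝ}
    (hi : ∀ w ∈ W, Integrable (f w) μ) (hf : ∀ z, LipschitzBoundOn W G (fun w => f w z))
    {w u : Vec d} (hw : w ∈ W) (hu : u ∈ W) :
    |(∫ z, f w z ∂μ) - ∫ z, f u z ∂μ| ≤ G * ‖w - u‖ := by
  rw [← integral_sub (hi w hw) (hi u hu)]
  have := norm_integral_le_of_norm_le_const (μ := μ) (f := fun z => f w z - f u z)
    (Filter.Eventually.of_forall fun z => hf z w hw u hu)
  simpa using this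

theorem abs_empirical_sub_le {d n : ℕ} {Z : Type*} {G : ℝ} {W : Set (Vec d)}
    {f : Vec d → Z → ℝ} (hn : 0 < n) (hf : ∀ z, LipschitzBoundOn W G (fun w => f w z))
    {w u : Vec d} (hw : w ∈ W) (hu : u ∈ W) (z : Fin n → Z) :
    |1 / (n : ℝ) * ∑ i, f w (z i) - 1 / (n : ℝ) * ∑ i, f u (z i)| ≤ G * ‖w - u‖ := by
  have hn' : (0 : ℝ) < n := Nat.cast_pos.2 hn
  rw [← mul_sub, ← Finset.sum_sub_distrib, abs_mul, abs_of_nonneg (by positivity)]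
  calc 1 / (n : ℝ) * |∑ i, (f w (z i) - f u (z i))|
      ≤ 1 / (n : ℝ) * ∑ _i : Fin n, G * ‖w - u‖ := by
        gcongr
        exact (Finset.abs_sum_le_sum_abs _ _).trans
          (Finset.sum_le_sum fun i _ => hf (z i) w hw u hu)
    _ = G * ‖w - u‖ := by
        rw [Finset.sum_const, Finset.card_univ, Fintype.card_fin, nsmul_eq_mul, ← mul_assoc,
          one_div_mul_cancel hn'.ne', one_mul]

/-- Uniform Bernstein inequality for the increments of the empirical risk over `W × W`, with
resolution `1 / n²`. -/
theorem exists_uniform_deviation {d n : ℕ} {Z : Type*} [MeasurableSpace Z] {μ : Measure Z}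
    [IsProbabilityMeasure μ] {R G G' L ρ θ α δ : ℝ} {W : Set (Vec d)} {f : Vec d → Z → ℝ}
    {r : Vec d → ℝ} (hR : 0 < R) (hG : 0 < G) (hL : 0 ≤ L) (hρ : 0 < ρ) (hn : 2 ≤ n)
    (hdn : d ≤ n) (hδ : 0 < δ) (hδ1 : δ < 1) (hA : RiskAssumptions R G G' L ρ θ α W μ f r) :
    ∃ A : Set (Fin n → Z), MeasurableSet A ∧
      ENNReal.ofReal (1 - δ) ≤ Measure.pi (fun _ : Fin n => μ) A ∧
      ∀ z ∈ A, ∀ w ∈ W, ∀ u ∈ W, ∀ ε s : ℝ, ε = 1 / (n : ℝ) ^ 2 →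
        s = (6 + 8 * R) * (complexity d n δ / n) →
        (∫ y, f w y ∂μ) - (∫ y, f u y ∂μ) -
          (1 / (n : ℝ) * ∑ i, f w (z i) - 1 / (n : ℝ) * ∑ i, f u (z i)) ≤
        4 * G * ε + (2 * √(2 * (L + 2 * G / ρ) * (‖w - u‖ + 2 * ε) ^ 2 *
          ((∫ y, f w y ∂μ) + (∫ y, f u y ∂μ) + 2 * G * ε) * s) +
          G * (‖w - u‖ + 3 * ε) * s) := by
  have hn0 : (0 : ℝ) < n := by exact_mod_cast (by omega : 0 < n)
  set ε : ℝ := 1 / (n : ℝ) ^ 2 with hε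
  have hε0 : 0 < ε := by positivity
  set s : ℝ := (6 + 8 * R) * (complexity d n δ / n) with hs
  have hC := complexity_pos (d := d) hn hδ hδ1
  have hs0 : 0 < s := by positivity
  obtain ⟨T, hTW, hTc, hTn⟩ := exists_finset_net (h := 1 / (n : ℝ) ^ 3) hR.le (by positivity)
    hA.norm_le
  have hnet : ∀ w ∈ W, ∃ u ∈ T, ‖w - u‖ ≤ ε := by
    intro w hw
    obtain ⟨u, hu, h⟩ := hTn w hw
    refine ⟨u, hu, h.trans ?_⟩
    -- The grid width n⁻³ leaves a factor n to pay for √d.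
    have h1 : √(d : ℝ) ≤ n := by
      rw [Real.sqrt_le_left hn0.le]
      have h2 : (d : ℝ) ≤ n := by exact_mod_cast hdn
      have h3 : (1 : ℝ) ≤ n := by exact_mod_cast (by omega : 1 ≤ n)
      nlinarith
    calc √(d : ℝ) * (1 / (n : ℝ) ^ 3) ≤ n * (1 / (n : ℝ) ^ 3) := by gcongr
      _ = ε := by rw [hε]; field_simp
  have hns : n * s = (6 + 8 * R) * complexity d n δ := by rw [hs]; field_simp
  -- The added ε in the range `G * (‖w - u‖ + ε)` keeps it positive on diagonal pairs, as
  -- Bernstein's inequality requires.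
  obtain ⟨A, hAm, hA1, hA2⟩ := exists_measurableSet_forall_pairs
    (Measure.pi (fun _ : Fin n => μ)) T
    (fun w u => {z | 2 * √(2 * (L + 2 * G / ρ) * ‖w - u‖ ^ 2 *
      ((∫ y, f w y ∂μ) + ∫ y, f u y ∂μ) * s) + G * (‖w - u‖ + ε) * s <
      (∫ y, (f w y - f u y) ∂μ) - 1 / (n : ℝ) * ∑ i, (f w (z i) - f u (z i))})
    (t := n * s) hδ.le
    (fun w hw u hu => pi_bernstein
      ((hA.integrable w (hTW w hw)).sub (hA.integrable u (hTW u hu))) (by omega) hs0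
      (by positivity)
      (fun z => (hA.lipschitz_loss z w (hTW w hw) u (hTW u hu)).trans
        (mul_le_mul_of_nonneg_left (by linarith) hG.le))
      (integral_sq_sub_le hG hL hρ hA (hTW w hw) (hTW u hu)))
    (by rw [hns]; exact card_sq_mul_exp_le hR.le hn hδ hδ1 hTc)
  refine ⟨A, hAm, hA1, ?_⟩
  rintro z hz w hw u hu _ _ rfl rfl
  obtain ⟨w', hw'T, hw'⟩ := hnet w hw
  obtain ⟨u', hu'T, hu'⟩ := hnet u hu
  have hw'W := hTW w' hw'T
  have hu'W := hTW u' hu'T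
  have h := hA2 z hz w' hw'T u' hu'T
  simp only [Set.mem_ofPred_eq, not_lt] at h
  rw [integral_sub (hA.integrable _ hw'W) (hA.integrable _ hu'W), Finset.sum_sub_distrib,
    mul_sub] at h
  -- Passing to net points changes two expectations and two empirical means by at most Gε each,
  -- whence `4 * G * ε`; the two expectations also give the `2 * G * ε` under the root.
  have a1 := abs_le.1 ((abs_integral_sub_le hA.integrable hA.lipschitz_loss hw hw'W).trans
    (mul_le_mul_of_nonneg_left hw' hG.le))
  have a2 := abs_le.1 ((abs_integral_sub_le hA.integrable hA.lipschitz_loss hu hu'W).trans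
    (mul_le_mul_of_nonneg_left hu' hG.le))
  have a3 := abs_le.1 ((abs_empirical_sub_le (by omega) hA.lipschitz_loss hw hw'W z).trans
    (mul_le_mul_of_nonneg_left hw' hG.le))
  have a4 := abs_le.1 ((abs_empirical_sub_le (by omega) hA.lipschitz_loss hu hu'W z).trans
    (mul_le_mul_of_nonneg_left hu' hG.le))
  have hd : ‖w' - u'‖ ≤ ‖w - u‖ + 2 * ε := by
    have e : w' - u' = (w - u) - (w - w') + (u - u') := by abel
    rw [e]
    linarith [norm_add_le ((w - u) - (w - w')) (u - u'), norm_sub_le (w - u) (w - w')]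
  have hpos : ∀ v ∈ W, 0 ≤ ∫ y, f v y ∂μ := fun v hv => integral_nonneg fun y =>
    (hA.smooth_loss y).1 v (Metric.self_subset_thickening hρ W hv)
  have b1 : √(2 * (L + 2 * G / ρ) * ‖w' - u'‖ ^ 2 *
      ((∫ y, f w' y ∂μ) + ∫ y, f u' y ∂μ) * s) ≤
      √(2 * (L + 2 * G / ρ) * (‖w - u‖ + 2 * ε) ^ 2 *
          ((∫ y, f w y ∂μ) + (∫ y, f u y ∂μ) + 2 * G * ε) * s) := by
    have := add_nonneg (hpos w' hw'W) (hpos u' hu'W)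
    have : (∫ y, f w' y ∂μ) + ∫ y, f u' y ∂μ ≤
      (∫ y, f w y ∂μ) + (∫ y, f u y ∂μ) + 2 * G * ε := by linarith
    gcongr
  have b2 : G * (‖w' - u'‖ + ε) * s ≤ G * (‖w - u‖ + 3 * ε) * s :=
    mul_le_mul_of_nonneg_right (mul_le_mul_of_nonneg_left (by linarith) hG.le) hs0.le
  linarith

/-! ### Real inequalities for the excess risk. -/

/-- Solving the deviation inequality for the excess risk `Δ`. -/
theorem excess_le_of_deviation {G M k R Δ P ε x D : ℝ} (hG : 0 ≤ G) (hM : 0 ≤ M) (hk : 0 ≤ k)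
    (hΔ : 0 ≤ Δ) (hP : 0 ≤ P) (hε : 0 ≤ ε) (hε1 : ε ≤ 1) (hx : 0 ≤ x) (hx1 : x ≤ 1)
    (hxP : x * P ≤ 1) (hD : 0 ≤ D) (hDR : D ≤ 2 * R)
    (h : Δ ≤ 4 * G * ε + (2 * √(M * (D + 2 * ε) ^ 2 * (2 * P + Δ + 2 * G * ε) * (k * x)) +
      G * (D + 3 * ε) * (k * x))) :
    Δ ≤ (10 * G + 16 * √(M * k) + 32 * (M * k) * (R + 1) + 6 * G * k) *
      (ε + D * x + D * √(x * P)) := by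
  set N := √(M * k) with hN
  have hN0 : 0 ≤ N := Real.sqrt_nonneg _
  have hN2 : N ^ 2 = M * k := Real.sq_sqrt (by positivity)
  set E := D + 2 * ε with hE
  have hE0 : 0 ≤ E := by positivity
  set y := √(x * P) with hy
  have hy0 : 0 ≤ y := Real.sqrt_nonneg _
  have hy1 : y ≤ 1 := Real.sqrt_le_one.2 hxP
  have hy2 : y ^ 2 = x * P := Real.sq_sqrt (by positivity)
  set a := √(x * Δ) with ha
  have ha0 : 0 ≤ a := Real.sqrt_nonneg _
  have ha2 : a ^ 2 = x * Δ := Real.sq_sqrt (by positivity)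
  set b := √(x * (2 * G * ε)) with hb
  have hb0 : 0 ≤ b := Real.sqrt_nonneg _
  have hb2 : b ^ 2 = x * (2 * G * ε) := Real.sq_sqrt (by positivity)
  have hNE : 0 ≤ N * E := by positivity
  have h1 : √(M * E ^ 2 * (2 * P + Δ + 2 * G * ε) * (k * x)) ≤ N * E * (2 * y + a + b) := by
    rw [Real.sqrt_le_left (by positivity), mul_pow, mul_pow, hN2]
    have e : M * E ^ 2 * (2 * P + Δ + 2 * G * ε) * (k * x) =
        M * k * E ^ 2 * (2 * y ^ 2 + a ^ 2 + b ^ 2) := by rw [hy2, ha2, hb2]; ring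
    rw [e]
    refine mul_le_mul_of_nonneg_left ?_ (by positivity)
    nlinarith [mul_nonneg hy0 ha0, mul_nonneg hy0 hb0, mul_nonneg ha0 hb0]
  have hsx : √x ^ 2 = x := Real.sq_sqrt hx
  -- With q = √Δ the first term is Δ/2, which the left-hand side absorbs; the price E²x is again of
  -- order Dx + ε because E is bounded.
  have amgm : ∀ c p q : ℝ, 2 * c * (p * q) ≤ q ^ 2 / 2 + 2 * c ^ 2 * p ^ 2 := fun c p q => by
    linarith [sq_nonneg (q - 2 * c * p)]
  have h2 : 2 * (N * E) * a ≤ Δ / 2 + 2 * (M * k) * E ^ 2 * x := by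
    have e : a = √x * √Δ := Real.sqrt_mul hx _
    have h := amgm (N * E) √x √Δ
    rw [Real.sq_sqrt hΔ, hsx, mul_pow, hN2] at h
    rw [e]
    linarith
  have h3 : 2 * (N * E) * b ≤ G * ε + 2 * (M * k) * E ^ 2 * x := by
    have e : b = √x * √(2 * G * ε) := Real.sqrt_mul hx _
    have h := amgm (N * E) √x √(2 * G * ε)
    rw [Real.sq_sqrt (by positivity), hsx, mul_pow, hN2] at h
    rw [e]
    linarith
  have hEx : E * x ≤ D * x + 2 * ε := by
    rw [hE]; linarith [mul_le_mul_of_nonneg_left hx1 hε]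
  have hEy : E * y ≤ D * y + 2 * ε := by
    rw [hE]; linarith [mul_le_mul_of_nonneg_left hy1 hε]
  have h4 : E ^ 2 * x ≤ 2 * (R + 1) * (D * x + 2 * ε) := by
    calc E ^ 2 * x = E * (E * x) := by ring
      _ ≤ (2 * (R + 1)) * (D * x + 2 * ε) := by
          refine mul_le_mul (by rw [hE]; linarith) hEx (by positivity) (by linarith)
  have h5 : G * (D + 3 * ε) * (k * x) ≤ G * k * (D * x + 3 * ε) := by
    calc _ = G * k * (D * x + 3 * ε * x) := by ring
      _ ≤ _ := by
        refine mul_le_mul_of_nonneg_left ?_ (by positivity)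
        linarith [mul_le_mul_of_nonneg_left hx1 hε]
  have h6 : M * k * (E ^ 2 * x) ≤ M * k * (2 * (R + 1) * (D * x + 2 * ε)) :=
    mul_le_mul_of_nonneg_left h4 (by positivity)
  have h7 : N * (E * y) ≤ N * (D * y + 2 * ε) := mul_le_mul_of_nonneg_left hEy hN0
  -- Doubling this and taking the largest coefficient in each of `G`, `N`, `M * k * (R + 1)` and `G
  -- * k` gives the stated constant.
  have h8 : Δ / 2 ≤ 5 * G * ε + 4 * N * (D * y + 2 * ε) +
      4 * (M * k) * (2 * (R + 1) * (D * x + 2 * ε)) + G * k * (D * x + 3 * ε) := by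
    linarith
  have hR : 0 ≤ R := by linarith
  have p1 : 0 ≤ D * x := by positivity
  have p2 : 0 ≤ D * y := by positivity
  have q1 : 0 ≤ M * k * (R + 1) := by positivity
  have q2 : 0 ≤ G * k := by positivity
  linarith [mul_nonneg hG p1, mul_nonneg hG p2, mul_nonneg hN0 p1, mul_nonneg hN0 p2,
    mul_nonneg q1 p1, mul_nonneg q1 p2, mul_nonneg q2 p1, mul_nonneg q2 p2,
    mul_nonneg q1 hε, mul_nonneg q2 hε, mul_nonneg hN0 hε]

/-- Solving `Δ ≤ k D √s` for `Δ` under an error bound `D² ≤ α Δ ^ θ`. -/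
theorem le_of_error_bound {Δ D k s θ α : ℝ} (hθ : 0 < θ) (hθ1 : θ ≤ 1) (hα : 0 < α)
    (hΔ : 0 ≤ Δ) (hk : 1 ≤ k) (hs : 0 ≤ s) (hD : D ^ 2 ≤ α * Δ ^ θ)
    (h : Δ ≤ k * (D * √s)) :
    Δ ≤ k ^ 2 * (max 1 (α ^ (1 / θ)) * s ^ (1 / (2 - θ))) := by
  have h2θ : 0 < 2 - θ := by linarith
  rcases hΔ.eq_or_lt with rfl | hpos
  · positivity
  have h1 : Δ ^ (2 - θ) ≤ k ^ 2 * s * α := by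
    have e : Δ ^ (2 - θ) * Δ ^ θ = Δ ^ 2 := by
      rw [← Real.rpow_add hpos]; norm_num
    have e2 : Δ ^ 2 ≤ k ^ 2 * s * α * Δ ^ θ := by
      calc Δ ^ 2 ≤ (k * (D * √s)) ^ 2 := pow_le_pow_left₀ hΔ h 2
        _ = k ^ 2 * s * D ^ 2 := by rw [mul_pow, mul_pow, Real.sq_sqrt hs]; ring
        _ ≤ k ^ 2 * s * (α * Δ ^ θ) := by gcongr
        _ = _ := by ring
    exact le_of_mul_le_mul_right (e.trans_le e2) (Real.rpow_pos_of_pos hpos θ)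
  have hexp : 1 / (2 - θ) ≤ 1 := by rw [div_le_one h2θ]; linarith
  have hexp0 : 0 ≤ 1 / (2 - θ) := by positivity
  have h2 : (k ^ 2) ^ (1 / (2 - θ)) ≤ k ^ 2 :=
    (Real.rpow_le_rpow_of_exponent_le (one_le_pow₀ hk) hexp).trans_eq (Real.rpow_one _)
  -- Uses 1/(2-θ) ≤ 1 ≤ 1/θ when α ≥ 1.
  have h3 : α ^ (1 / (2 - θ)) ≤ max 1 (α ^ (1 / θ)) := by
    rcases le_total α 1 with h | h
    · exact le_max_of_le_left (Real.rpow_le_one hα.le h hexp0)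
    · refine le_max_of_le_right (Real.rpow_le_rpow_of_exponent_le h (hexp.trans ?_))
      rw [le_div_iff₀ hθ]; linarith
  calc Δ = (Δ ^ (2 - θ)) ^ (1 / (2 - θ)) := by
        rw [← Real.rpow_mul hΔ, mul_one_div_cancel h2θ.ne', Real.rpow_one]
    _ ≤ (k ^ 2 * s * α) ^ (1 / (2 - θ)) :=
        Real.rpow_le_rpow (Real.rpow_nonneg hΔ _) h1 hexp0
    _ = (k ^ 2) ^ (1 / (2 - θ)) * α ^ (1 / (2 - θ)) * s ^ (1 / (2 - θ)) := by
        rw [Real.mul_rpow (by positivity) hα.le, Real.mul_rpow (by positivity) hs]; ring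
    _ ≤ k ^ 2 * max 1 (α ^ (1 / θ)) * s ^ (1 / (2 - θ)) := by gcongr
    _ = _ := by ring

/-! ### Excess risk of empirical minimizers. -/

theorem abs_risk_sub_le {d : ℕ} {Z : Type*} [MeasurableSpace Z] {μ : Measure Z}
    [IsProbabilityMeasure μ] {R G G' L ρ θ α : ℝ} {W : Set (Vec d)} {f : Vec d → Z → ℝ}
    {r : Vec d → ℝ} (hA : RiskAssumptions R G G' L ρ θ α W μ f r) {w u : Vec d}
    (hw : w ∈ W) (hu : u ∈ W) :
    |risk μ f r w - risk μ f r u| ≤ (G + G') * ‖w - u‖ := by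
  unfold risk
  have h1 := abs_le.1 (abs_integral_sub_le hA.integrable hA.lipschitz_loss hw hu)
  have h2 := abs_le.1 (hA.lipschitz_reg w hw u hu)
  exact abs_le.2 ⟨by linarith, by linarith⟩

/-- A continuous function on a non-empty compact set attains its minimum at a point closest to
any given point. -/
theorem exists_closest_argminOn {d : ℕ} {W : Set (Vec d)} {φ : Vec d → ℝ} (hW : IsCompact W)
    (hφ : ContinuousOn φ W) {w : Vec d} (hw : w ∈ W) :
    ∃ w' ∈ argminOn W φ, (∀ u ∈ argminOn W φ, ‖w' - w‖ ≤ ‖u - w‖) ∧ optValue W φ = φ w' := by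
  obtain ⟨v, hv, hmin⟩ := hW.exists_isMinOn ⟨w, hw⟩ hφ
  have hset : argminOn W φ = W ∩ φ ⁻¹' Set.Iic (φ v) := by
    ext u
    refine ⟨fun h => ⟨h.1, h.2 v hv⟩, fun h => ⟨h.1, fun x hx => ?_⟩⟩
    exact le_trans (Set.mem_Iic.1 h.2) (hmin hx)
  have hcl : IsClosed (argminOn W φ) := by
    rw [hset]; exact hφ.preimage_isClosed_of_isClosed hW.isClosed isClosed_Iic
  have hcp : IsCompact (argminOn W φ) := hW.of_isClosed_subset hcl fun u hu => hu.1
  obtain ⟨w', hw', hmin'⟩ := hcp.exists_isMinOn (f := fun u => ‖u - w‖)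
    ⟨v, hv, fun x hx => hmin hx⟩ (by fun_prop)
  refine ⟨w', hw', fun u hu => hmin' hu, le_antisymm ?_ ?_⟩
  · exact csInf_le ⟨φ w', by rintro _ ⟨u, hu, rfl⟩; exact hw'.2 u hu⟩ ⟨w', hw'.1, rfl⟩
  · exact le_csInf ⟨_, w', hw'.1, rfl⟩ (by rintro _ ⟨u, hu, rfl⟩; exact hw'.2 u hu)

/-- The excess risk of empirical minimizers in terms of the distance `D` to the minimizers of
the risk. -/
theorem exists_excess_risk_bound {R G G' L ρ : ℝ} (hR : 0 < R) (hG : 0 < G) (hL : 0 ≤ L)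
    (hρ : 0 < ρ) :
    ∃ K : ℝ, 1 ≤ K ∧
      ∀ {d n : ℕ} {θ α δ : ℝ} {Z : Type*} [MeasurableSpace Z] {μ : Measure Z}
        [IsProbabilityMeasure μ] {W : Set (Vec d)} {f : Vec d → Z → ℝ} {r : Vec d → ℝ},
        2 ≤ n → d ≤ n → 0 < δ → δ < 1 → RiskAssumptions R G G' L ρ θ α W μ f r →
        complexity d n δ / n ≤ 1 →
        complexity d n δ / n * optValue W (risk μ f r) ≤ 1 →
        ∃ A : Set (Fin n → Z), MeasurableSet A ∧
          ENNReal.ofReal (1 - δ) ≤ Measure.pi (fun _ : Fin n => μ) A ∧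
          ∀ z ∈ A, ∀ w ∈ argminOn W (empRisk f r z), ∀ u ∈ argminOn W (risk μ f r),
            optValue W (risk μ f r) = risk μ f r u →
            risk μ f r w - risk μ f r u ≤ K * (1 / (n : ℝ) ^ 2 +
              ‖w - u‖ * (complexity d n δ / n) +
              ‖w - u‖ * √(complexity d n δ / n * optValue W (risk μ f r))) := by
  set M := 2 * (L + 2 * G / ρ) with hM
  have hM0 : 0 ≤ M := by positivity
  set k := 6 + 8 * R with hk
  have hk0 : 0 ≤ k := by positivity
  -- The final 1 secures `1 ≤ K`, so that 3K can serve as the `k ≥ 1` of `le_of_error_bound`.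
  refine ⟨10 * G + 16 * √(M * k) + 32 * (M * k) * (R + 1) + 6 * G * k + 1,
    le_add_of_nonneg_left (by positivity), ?_⟩
  intro d n θ α δ Z _ μ _ W f r hn hdn hδ hδ1 hA hx1 hxP
  obtain ⟨A, hAm, hA1, hA2⟩ := exists_uniform_deviation hR hG hL hρ hn hdn hδ hδ1 hA
  refine ⟨A, hAm, hA1, fun z hz w hw u hu hopt => ?_⟩
  have hn1 : (1 : ℝ) ≤ n := by exact_mod_cast (by omega : 1 ≤ n)
  have hn0 : (0 : ℝ) < n := by linarith
  have hx0 : 0 ≤ complexity d n δ / n := div_nonneg (complexity_pos hn hδ hδ1).le hn0.le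
  have hdev := hA2 z hz w hw.1 u hu.1 _ _ rfl rfl
  rw [hopt] at hxP ⊢
  have hemp := hw.2 u hu.1
  have hΔ : 0 ≤ risk μ f r w - risk μ f r u := sub_nonneg.2 (hu.2 w hw.1)
  have hFu : (∫ y, f u y ∂μ) ≤ risk μ f r u := by
    unfold risk; linarith [hA.nonneg_reg u hu.1]
  have hFu0 : 0 ≤ ∫ y, f u y ∂μ := integral_nonneg fun y =>
    (hA.smooth_loss y).1 u (Metric.self_subset_thickening hρ W hu.1)
  have hFw0 : 0 ≤ ∫ y, f w y ∂μ := integral_nonneg fun y =>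
    (hA.smooth_loss y).1 w (Metric.self_subset_thickening hρ W hw.1)
  have hFw : (∫ y, f w y ∂μ) ≤ risk μ f r w := by
    unfold risk; linarith [hA.nonneg_reg w hw.1]
  have hD : ‖w - u‖ ≤ 2 * R := by
    linarith [norm_sub_le w u, hA.norm_le w hw.1, hA.norm_le u hu.1]
  have hε0 : 0 ≤ 1 / (n : ℝ) ^ 2 := by positivity
  have hε1 : 1 / (n : ℝ) ^ 2 ≤ 1 := by
    rw [div_le_one (by positivity)]; exact one_le_pow₀ hn1
  -- The regularizer contributes equally to the risk and the empirical risk, so it cancels.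
  have hle : risk μ f r w - risk μ f r u ≤ (∫ y, f w y ∂μ) - (∫ y, f u y ∂μ) -
      (1 / (n : ℝ) * ∑ i, f w (z i) - 1 / (n : ℝ) * ∑ i, f u (z i)) := by
    unfold empRisk at hemp
    unfold risk
    linarith
  have hmono : √(M * (‖w - u‖ + 2 * (1 / (n : ℝ) ^ 2)) ^ 2 *
      ((∫ y, f w y ∂μ) + (∫ y, f u y ∂μ) + 2 * G * (1 / (n : ℝ) ^ 2)) *
        (k * (complexity d n δ / n))) ≤
      √(M * (‖w - u‖ + 2 * (1 / (n : ℝ) ^ 2)) ^ 2 *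
      (2 * risk μ f r u + (risk μ f r w - risk μ f r u) + 2 * G * (1 / (n : ℝ) ^ 2)) *
        (k * (complexity d n δ / n))) := by
    have : (∫ y, f w y ∂μ) + (∫ y, f u y ∂μ) ≤
      2 * risk μ f r u + (risk μ f r w - risk μ f r u) := by linarith
    gcongr
  have hfin := excess_le_of_deviation hG.le hM0 hk0 hΔ (hFu0.trans hFu) hε0 hε1 hx0 hx1 hxP
    (norm_nonneg _) hD (hle.trans (hdev.trans (by linarith)))
  refine hfin.trans (mul_le_mul_of_nonneg_right (by linarith) (by positivity))

/-! ### Degenerate regimes and the final case analysis. -/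

theorem theorem2 (R G G' L ρ : ℝ) (hR : 0 < R) (hG : 0 < G) (hG' : 0 ≤ G') (hL : 0 ≤ L)
    (hρ : 0 < ρ) :
    ∃ c K : ℝ, 0 < c ∧ 0 < K ∧
      ∀ (d n : ℕ) (θ α δ : ℝ) {Z : Type*} [MeasurableSpace Z] (μ : Measure Z)
        [IsProbabilityMeasure μ] (W : Set (Vec d)) (f : Vec d → Z → ℝ) (r : Vec d → ℝ),
        0 < θ → θ ≤ 1 → 0 < α → 2 ≤ n → 0 < δ → δ < 1 →
        RiskAssumptions R G G' L ρ θ α W μ f r →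
        ERMBound n δ W μ f r
          (K * (complexity d n δ / n + max 1 (α ^ (1 / θ)) *
            (complexity d n δ * optValue W (risk μ f r) / n) ^ (1 / (2 - θ)))) ∧
        (c * (α ^ (1 / θ) * ((d : ℝ) * Real.log n)) ^ (2 - θ) ≤ (n : ℝ) →
          ERMBound n δ W μ f r
            (K * max 1 (α ^ (1 / θ)) * ((complexity d n δ / n) ^ (2 / (2 - θ)) +
              (complexity d n δ * optValue W (risk μ f r) / n) ^ (1 / (2 - θ))))) := by
  obtain ⟨K₀, hK₀, hmain⟩ := exists_excess_risk_bound (G' := G') hR hG hL hρ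
  set B := (G + G') * (2 * R) with hB
  have hB0 : 0 < B := by positivity
  -- One summand per case: the trivial bound B, the n⁻² term, the D x term with D ≤ 2R, and (3K₀)²
  -- from the error bound.
  refine ⟨1, 4 * B + 12 * K₀ + 6 * K₀ * R + 9 * K₀ ^ 2, one_pos, by positivity, ?_⟩
  intro d n θ α δ Z _ μ _ W f r hθ hθ1 hα hn hδ hδ1 hA
  set K := 4 * B + 12 * K₀ + 6 * K₀ * R + 9 * K₀ ^ 2 with hK
  have hKR : 0 ≤ K₀ * R := by positivity
  have hKsq : 0 ≤ K₀ ^ 2 := sq_nonneg _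
  have hKB : 4 * B ≤ K := by linarith
  have hK1 : 12 * K₀ ≤ K := by linarith
  have hK2 : 6 * K₀ * R ≤ K := by linarith
  have hK3 : (3 * K₀) ^ 2 ≤ K := by linarith
  have hK0 : 0 < K := by linarith
  have hn1 : (1 : ℝ) ≤ n := by exact_mod_cast (by omega : 1 ≤ n)
  have hn0 : (0 : ℝ) < n := by linarith
  have hlog := half_le_log_natCast hn
  have hC := complexity_pos (d := d) hn hδ hδ1
  set x := complexity d n δ / n with hx
  have hx0 : 0 < x := div_pos hC hn0
  set P := optValue W (risk μ f r) with hP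
  rw [mul_div_right_comm, ← hx]
  set m := max 1 (α ^ (1 / θ)) with hm
  have hm1 : 1 ≤ m := le_max_left _ _
  have h2θ : 0 < 2 - θ := by linarith
  have hexp0 : 0 < 1 / (2 - θ) := by positivity
  have hexp2 : 2 / (2 - θ) ≤ 2 := by rw [div_le_iff₀ h2θ]; linarith
  have hP0 : 0 ≤ P := by
    refine Real.sInf_nonneg ?_
    rintro _ ⟨w, hw, rfl⟩
    exact add_nonneg (integral_nonneg fun y => (hA.smooth_loss y).1 w
      (Metric.self_subset_thickening hρ W hw)) (hA.nonneg_reg w hw)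
  have hcpt : IsCompact W := Metric.isCompact_of_isClosed_isBounded hA.isClosed
    ((Metric.isBounded_closedBall (x := (0 : Vec d)) (r := R)).subset fun w hw => by
      simpa using hA.norm_le w hw)
  have hcont : ContinuousOn (risk μ f r) W := by
    have : LipschitzOnWith (Real.toNNReal (G + G')) (risk μ f r) W :=
      LipschitzOnWith.of_dist_le_mul fun w hw u hu => by
        rw [Real.coe_toNNReal _ (by positivity), Real.dist_eq, dist_eq_norm]
        exact abs_risk_sub_le hA hw hu
    exact this.continuousOn
  have hrpow0 : 0 ≤ (x * P) ^ (1 / (2 - θ)) := by positivity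
  have hxrpow0 : 0 ≤ x ^ (2 / (2 - θ)) := by positivity
  -- It suffices to bound the excess risk by either of the two right-hand sides on one event.
  suffices h : ∃ A : Set (Fin n → Z), MeasurableSet A ∧
      ENNReal.ofReal (1 - δ) ≤ Measure.pi (fun _ : Fin n => μ) A ∧
      ∀ z ∈ A, ∀ w ∈ argminOn W (empRisk f r z),
        risk μ f r w - P ≤ K * (x + m * (x * P) ^ (1 / (2 - θ))) ∧
        risk μ f r w - P ≤ K * m * (x ^ (2 / (2 - θ)) + (x * P) ^ (1 / (2 - θ))) by
    obtain ⟨A, hAm, hA1, hA2⟩ := h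
    exact ⟨⟨A, hAm, hA1, fun z hz w hw => (hA2 z hz w hw).1⟩,
      fun _ => ⟨A, hAm, hA1, fun z hz w hw => (hA2 z hz w hw).2⟩⟩
  have htriv : ∀ w ∈ W, risk μ f r w - P ≤ B := by
    intro w hw
    obtain ⟨u, hu, -, hopt⟩ := exists_closest_argminOn hcpt hcont hw
    rw [hP, hopt]
    refine (le_abs_self _).trans ((abs_risk_sub_le hA hw hu.1).trans ?_)
    rw [hB]
    gcongr
    linarith [norm_sub_le w u, hA.norm_le w hw, hA.norm_le u hu.1]
  by_cases hd : d = 0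
  · subst hd
    refine ⟨Set.univ, MeasurableSet.univ, ?_, fun z _ w hw => ?_⟩
    · rw [measure_univ]
      exact ENNReal.ofReal_le_one.2 (by linarith)
    · obtain ⟨u, hu, -, hopt⟩ := exists_closest_argminOn hcpt hcont hw.1
      have : risk μ f r w - P = 0 := by rw [hP, hopt, Subsingleton.elim w u, sub_self]
      rw [this]
      exact ⟨by positivity, by positivity⟩
  -- Here both brackets multiplying `K` are at least 1/4, so the Lipschitz bound B on the excess
  -- risk suffices.
  by_cases hbig : 1 / 2 ≤ x ∨ 1 ≤ x * P
  · refine ⟨Set.univ, MeasurableSet.univ, ?_, fun z _ w hw => ?_⟩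
    · rw [measure_univ]
      exact ENNReal.ofReal_le_one.2 (by linarith)
    have hw' := htriv w hw.1
    have h1 : 1 / 4 ≤ x + m * (x * P) ^ (1 / (2 - θ)) := by
      rcases hbig with h | h
      · have := mul_nonneg (zero_le_one.trans hm1) hrpow0
        linarith
      · have := Real.one_le_rpow h hexp0.le
        nlinarith
    have h2 : 1 / 4 ≤ m * (x ^ (2 / (2 - θ)) + (x * P) ^ (1 / (2 - θ))) := by
      have : 1 / 4 ≤ x ^ (2 / (2 - θ)) + (x * P) ^ (1 / (2 - θ)) := by
        rcases hbig with h | h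
        · have e1 : ((1 : ℝ) / 2) ^ (2 : ℝ) ≤ (1 / 2) ^ (2 / (2 - θ)) :=
            Real.rpow_le_rpow_of_exponent_ge (by norm_num) (by norm_num) hexp2
          have e2 : ((1 : ℝ) / 2) ^ (2 / (2 - θ)) ≤ x ^ (2 / (2 - θ)) :=
            Real.rpow_le_rpow (by norm_num) h (by positivity)
          have e3 : ((1 : ℝ) / 2) ^ (2 : ℝ) = 1 / 4 := by norm_num
          linarith
        · have := Real.one_le_rpow h hexp0.le
          linarith
      exact this.trans (le_mul_of_one_le_left (by positivity) hm1)
    have h3 : ∀ t, 1 / 4 ≤ t → B ≤ K * t := fun t ht => by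
      calc B = 4 * B * (1 / 4) := by ring
        _ ≤ K * t := mul_le_mul hKB ht (by norm_num) hK0.le
    exact ⟨hw'.trans (h3 _ h1), hw'.trans (by rw [mul_assoc]; exact h3 _ h2)⟩
  push Not at hbig
  obtain ⟨hx2, hxP1⟩ := hbig
  have hd1 : (1 : ℝ) ≤ d := by exact_mod_cast Nat.one_le_iff_ne_zero.2 hd
  have hClog : (d : ℝ) * Real.log n ≤ complexity d n δ := by
    unfold complexity
    linarith [Real.log_nonneg (show 1 ≤ 1 / δ by rw [le_div_iff₀ hδ]; linarith)]
  have hxn : x * n = complexity d n δ := div_mul_cancel₀ _ hn0.ne'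
  -- From d/2 ≤ d log n ≤ C = xn < n/2.
  have hdn : d ≤ n := by
    have h1 : x * n ≤ 1 / 2 * n := mul_le_mul_of_nonneg_right hx2.le hn0.le
    have h2 : (d : ℝ) * (1 / 2) ≤ d * Real.log n := by gcongr
    have : (d : ℝ) ≤ n := by linarith
    exact_mod_cast this
  -- Since d ≥ 1, xn = C ≥ log n ≥ 1/2; this is why d = 0 was treated apart.
  have hεx : 1 / (n : ℝ) ^ 2 ≤ 4 * x ^ 2 := by
    rw [div_le_iff₀ (by positivity)]
    have h1 : 1 * (1 / 2) ≤ d * Real.log n := mul_le_mul hd1 hlog (by norm_num) (by linarith)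
    have h2 : 1 / 2 ≤ x * n := by linarith
    have h3 := pow_le_pow_left₀ (by norm_num) h2 2
    rw [mul_pow] at h3
    linarith
  have hx2x : x ^ 2 ≤ x := by
    rw [sq]; exact mul_le_of_le_one_left hx0.le (by linarith)
  have hxpow : x ^ 2 ≤ x ^ (2 / (2 - θ)) := by
    rw [← Real.rpow_two]
    exact Real.rpow_le_rpow_of_exponent_ge hx0 (by linarith) hexp2
  obtain ⟨A, hAm, hA1, hA2⟩ := hmain hn hdn hδ hδ1 hA (by linarith) hxP1.le
  refine ⟨A, hAm, hA1, fun z hz w hw => ?_⟩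
  obtain ⟨u, hu, hclose, hopt⟩ := exists_closest_argminOn hcpt hcont hw.1
  have hmainw := hA2 z hz w hw u hu hopt
  have heb := hA.error_bound w hw.1 u hu hclose
  rw [← hopt, ← hP] at hmainw heb
  have hΔ0 : 0 ≤ risk μ f r w - P := by rw [hP, hopt]; exact sub_nonneg.2 (hu.2 w hw.1)
  have hDR : ‖w - u‖ ≤ 2 * R := by
    linarith [norm_sub_le w u, hA.norm_le w hw.1, hA.norm_le u hu.1]
  set Δ := risk μ f r w - P
  set D := ‖w - u‖
  have hD0 : 0 ≤ D := norm_nonneg _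
  have hmr : 0 ≤ m * (x * P) ^ (1 / (2 - θ)) := by positivity
  have hmx : x ^ (2 / (2 - θ)) ≤ m * x ^ (2 / (2 - θ)) := le_mul_of_one_le_left hxrpow0 hm1
  have hsplit : K * m * (x ^ (2 / (2 - θ)) + (x * P) ^ (1 / (2 - θ))) =
      K * (m * x ^ (2 / (2 - θ)) + m * (x * P) ^ (1 / (2 - θ))) := by ring
  rw [hsplit]
  -- The largest of three summands is at least a third of their sum.
  have hcases : Δ ≤ 3 * K₀ * (1 / (n : ℝ) ^ 2) ∨ Δ ≤ 3 * K₀ * (D * x) ∨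
      Δ ≤ 3 * K₀ * (D * √(x * P)) := by
    by_contra! h
    linarith [h.1, h.2.1, h.2.2]
  rcases hcases with h | h | h
  · have h1 : Δ ≤ K * x ^ 2 := by
      calc Δ ≤ 3 * K₀ * (1 / (n : ℝ) ^ 2) := h
        _ ≤ 3 * K₀ * (4 * x ^ 2) := by gcongr
        _ = 12 * K₀ * x ^ 2 := by ring
        _ ≤ K * x ^ 2 := by gcongr
    constructor
    · exact h1.trans (mul_le_mul_of_nonneg_left (by linarith) hK0.le)
    · exact h1.trans (mul_le_mul_of_nonneg_left (by linarith) hK0.le)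
  · constructor
    · have h1 : Δ ≤ K * x := by
        calc Δ ≤ 3 * K₀ * (D * x) := h
          _ ≤ 3 * K₀ * (2 * R * x) := by gcongr
          _ = 6 * K₀ * R * x := by ring
          _ ≤ K * x := by gcongr
      exact h1.trans (mul_le_mul_of_nonneg_left (by linarith) hK0.le)
    · have h1 := le_of_error_bound (k := 3 * K₀) (s := x ^ 2) hθ hθ1 hα hΔ0
        (by linarith) (sq_nonneg x) heb (by rwa [Real.sqrt_sq hx0.le])
      have h2 : (x ^ 2) ^ (1 / (2 - θ)) = x ^ (2 / (2 - θ)) := by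
        rw [← Real.rpow_two, ← Real.rpow_mul hx0.le, mul_one_div]
      rw [h2] at h1
      exact h1.trans (mul_le_mul hK3 (by linarith) (by positivity) hK0.le)
  · have h1 := le_of_error_bound hθ hθ1 hα hΔ0 (by linarith) (by positivity) heb h
    constructor
    · exact h1.trans (mul_le_mul hK3 (by linarith) hmr hK0.le)
    · exact h1.trans (mul_le_mul hK3 (by linarith) hmr hK0.le)
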